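/- Let $\mathbb{P}$ be a (non-empty) poset with the countable chain condition, let $\kappa$ be a measurable cardinal, that is, an uncountable cardinal with a $\kappa$-complete non-principal ultrafilter, and fix such an ultrafilter $\mathcal{D}$ on $\kappa$; "for $\mathcal{D}$-many $\alpha$" means "for all $\alpha$ in some set belonging to $\mathcal{D}$". Let $\mathbb{P}^\kappa/\mathcal{D}$ be the ultrapower: the classes $\bar p$ of functions $p=\langle p_\alpha\rangle_{\alpha<\kappa}\in\mathbb{P}^\kappa$ modulo equality for $\mathcal{D}$-many $\alpha$, ordered by $\bar p\le\bar q$ iff $p_\alpha\le q_\alpha$ for $\mathcal{D}$-many $\alpha$. Let $\langle\dot f_\alpha\rangle_{\alpha<\kappa}$ be a sequence of $\mathbb{P}$-names of reals (elements of $\omega^\omega$). Say that a $\mathbb{P}^\kappa/\mathcal{D}$-name $\dot f$ of a real is of the form $\langle\dot f_\alpha\rangle_{\alpha<\kappa}/\mathcal{D}$ if there are maximal antichains $\{p_\alpha^{n,j} : j<\omega\}$ of $\mathbb{P}$ (enumerated possibly with repetitions) and functions $k_\alpha^n:\omega\to\omega$ (for $\alpha<\kappa$, $n<\omega$), and functions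 $k^n:\omega\to\omega$ (for $n<\omega$), such that $p_\alpha^{n,j}\Vdash_{\mathbb{P}}\dot f_\alpha(n)=k_\alpha^n(j)$ for all $\alpha,n,j$; for $\mathcal{D}$-many $\alpha$, $k_\alpha^n=k^n$ for all $n$; and, with $\bar p^{n,j}$ the class of $\langle p_\alpha^{n,j}\rangle_{\alpha<\kappa}$, $\bar p^{n,j}\Vdash_{\mathbb{P}^\kappa/\mathcal{D}}\dot f(n)=k^n(j)$ for all $n,j<\omega$. Here $\boldsymbol\Sigma^1_0=\boldsymbol\Pi^1_0$ consists of the properties $x\in[T]$ of finite tuples $x$ of reals, where $T$ is a ground-model tree of finite sequences and $[T]$ is the set of its branches; for $m\ge 0$, a $\boldsymbol\Sigma^1_{m+1}$ property is one of the form $\exists y\in\omega^\omega\,\psi(x,y)$ with $\psi$ a $\boldsymbol\Pi^1_m$ property, and a $\boldsymbol\Pi^1_{m+1}$ property is the negation of a $\boldsymbol\Sigma^1_{m+1}$ property. In the forcing relation these definitions are interpreted in the generic extension. Then there is a $\mathbb{P}^\kappa/\mathcal{D}$-name of a real of the form $\langle\dot f_\alpha\rangle_{\alpha<\kappa}/\mathcal{D}$.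 Moreover, for every such name $\dot f$, every $m<\omega$, every $\boldsymbol\Sigma^1_m$ property $\varphi(x)$ of one real, and every $\bar p\in\mathbb{P}^\kappa/\mathcal{D}$, $$\bar p\Vdash_{\mathbb{P}^\kappa/\mathcal{D}}\varphi(\dot f)\quad\Longleftrightarrow\quad p_\alpha\Vdash_{\mathbb{P}}\varphi(\dot f_\alpha)\ \text{ for $\mathcal{D}$-many }\alpha<\kappa .$$ -/

import Mathlib

universe u

namespace Forcing

/-! ### Posets: compatibility, antichains, the countable chain condition -/

section Posets

variable {P : Type u} [Preorder P]

/-- `p` and `q` have a common extension (stronger conditions are smaller). -/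
def Compat (p q : P) : Prop := ∃ r, r ≤ p ∧ r ≤ q

/-- An antichain in the sense of forcing: distinct elements are incompatible. -/
def IsIncompatFamily (A : Set P) : Prop := A.Pairwise fun p q => ¬ Compat p q

/-- A maximal antichain: an antichain such that every condition is compatible with a member. -/
def IsMaxAntichain (A : Set P) : Prop :=
  IsIncompatFamily A ∧ ∀ q, ∃ a ∈ A, Compat q a

variable (P) in
/-- The countable chain condition: every antichain is countable. -/
def CCC : Prop := ∀ A : Set P, IsIncompatFamily A → A.Countable

end Posets

/-! ### Names -/

/-- `P`-names: a name is a (small) set of pairs `(name, condition)`, presented as an indexed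
family, in the same way in which `PSet` presents sets. The ground model is the universe of sets
`PSet.{u}`, to which `P : Type u` belongs. -/
inductive Name (P : Type u) : Type (u + 1)
  | mk (ι : Type u) (A : ι → Name P) (c : ι → P) : Name P

namespace Name

variable {P : Type u}

/-- The canonical name of a ground model set. As `P` need not have a largest element, every
condition is attached to every member: `x̌ = {(y̌, p) : y ∈ x, p ∈ P}`. -/
def check : PSet.{u} → Name P
  | ⟨ι, A⟩ => ⟨ι × P, fun i => check (A i.1), fun i => i.2⟩

/-- The canonical name of a natural number (a von Neumann ordinal). -/
def nat (n : ℕ) : Name P := check (PSet.ofNat n)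

/-- The canonical name of the set `ω`. -/
def omega : Name P := check PSet.omega

/-- The name of the unordered pair `{σ, τ}`. -/
def upair (σ τ : Name P) : Name P :=
  ⟨ULift.{u} Bool × P, fun i => if i.1.down then σ else τ, fun i => i.2⟩

/-- The name of the Kuratowski ordered pair `(σ, τ) = {{σ}, {σ, τ}}`. -/
def opair (σ τ : Name P) : Name P := upair (upair σ σ) (upair σ τ)

end Name

/-! ### The forcing relation

A statement `φ` of the forcing language is represented by its forcing relation: `φ p` is read
`p ⊩ φ`. The atomic statements are those of set theory (equality and membership of names), and
the connectives and quantifiers follow the usual recursive definition of forcing. -/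

/-- Statements of the forcing language of `P`; `φ p` is `p ⊩ φ`. -/
abbrev Stmt (P : Type u) : Type u := P → Prop

section Forces

variable {P : Type u} [Preorder P]

/-- `p ⊩ σ = τ`: for every `(π, s) ∈ σ`, every `q ≤ p, s` has an extension `r` and a pair
`(π', s') ∈ τ` with `r ≤ s'` and `r ⊩ π = π'`; and symmetrically. -/
def eq : Name P → Name P → Stmt P
  | ⟨ι, A, c⟩, ⟨κ, B, d⟩ => fun p =>
    (∀ i : ι, ∀ q, q ≤ p → q ≤ c i → ∃ r, r ≤ q ∧ ∃ j : κ, r ≤ d j ∧ eq (A i) (B j) r) ∧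
    (∀ j : κ, ∀ q, q ≤ p → q ≤ d j → ∃ r, r ≤ q ∧ ∃ i : ι, r ≤ c i ∧ eq (A i) (B j) r)

/-- `p ⊩ σ ∈ τ`: the set of `r` such that `r ≤ s` and `r ⊩ σ = π` for some `(π, s) ∈ τ` is dense
below `p`. -/
def mem (σ : Name P) : Name P → Stmt P
  | ⟨κ, B, d⟩ => fun p => ∀ q, q ≤ p → ∃ r, r ≤ q ∧ ∃ j : κ, r ≤ d j ∧ eq σ (B j) r

/-- `p ⊩ ¬ φ` iff no extension of `p` forces `φ`. -/
def not (φ : Stmt P) : Stmt P := fun p => ∀ q, q ≤ p → ¬ φ q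

/-- `p ⊩ φ ∧ ψ`. -/
def and (φ ψ : Stmt P) : Stmt P := fun p => φ p ∧ ψ p

/-- `p ⊩ φ → ψ` iff every extension of `p` that forces `φ` forces `ψ`. -/
def imp (φ ψ : Stmt P) : Stmt P := fun p => ∀ q, q ≤ p → φ q → ψ q

/-- `p ⊩ ∀ x, φ x`. The range `X` of the quantifier is the class of all names, or a set of the
ground model: `p` forces `∀ s ∈ X̌, φ s` iff it forces `φ š` for every `s ∈ X`. -/
def all {X : Type*} (φ : X → Stmt P) : Stmt P := fun p => ∀ x, φ x p

/-- `p ⊩ ∃ x, φ x` iff the set of `r` that force `φ x` for some `x` is dense below `p`. The range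
`X` of the quantifier is the class of all names, or a set of the ground model. -/
def ex {X : Type*} (φ : X → Stmt P) : Stmt P := fun p => ∀ q, q ≤ p → ∃ r, r ≤ q ∧ ∃ x, φ x r

/-! ### Names of reals -/

/-- The statement "`f` is a function from `ω` to `ω`": every element of `f` is an ordered pair of
natural numbers, and for every `x ∈ ω` there is exactly one `y ∈ ω` with `(x, y) ∈ f`. -/
def isReal (f : Name P) : Stmt P :=
  and
    (all fun z : Name P => imp (mem z f)
      (ex fun x : Name P => and (mem x Name.omega)
        (ex fun y : Name P => and (mem y Name.omega) (eq z (Name.opair x y)))))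
    (all fun x : Name P => imp (mem x Name.omega)
      (and
        (ex fun y : Name P => and (mem y Name.omega) (mem (Name.opair x y) f))
        (all fun y : Name P => all fun y' : Name P =>
          imp (mem (Name.opair x y) f) (imp (mem (Name.opair x y') f) (eq y y')))))

/-- `f` is a `P`-name of a real: every condition forces that `f` is a function from `ω` to `ω`. -/
def IsRealName (f : Name P) : Prop := ∀ p, isReal f p

/-- The statement `f(n) = k` for natural numbers `n, k`. -/
def value (f : Name P) (n k : ℕ) : Stmt P := mem (Name.opair (Name.nat n) (Name.nat k)) f

end Forces

/-! ### Projective properties of reals -/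

/-- Definitions of projective properties of `n` reals, with real parameters (the trees). A tree
`T` on `ω^n` defines the closed set `[T]` of the `n`-tuples `x` of reals such that
`(x ↾ k) ∈ T` for all `k`; in `ex φ` the quantified real is the last of the `n + 1` arguments
of `φ`. -/
inductive ProjFormula : ℕ → Type
  | closed {n : ℕ} (T : Descriptive.tree (Fin n → ℕ)) : ProjFormula n
  | neg {n : ℕ} (φ : ProjFormula n) : ProjFormula n
  | ex {n : ℕ} (φ : ProjFormula (n + 1)) : ProjFormula n

namespace ProjFormula

/-- `φ` is `Π¹_m` (boldface): a closed set for `m = 0`, and the negation of a `Σ¹_m` formula,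
that is of some `∃ y ∈ ω^ω, ψ` with `ψ` in `Π¹_{m-1}`, for `m > 0`. -/
def IsPi : ℕ → ∀ {n : ℕ}, ProjFormula n → Prop
  | 0, _, φ => ∃ T, φ = closed T
  | m + 1, n, φ => ∃ ψ : ProjFormula (n + 1), IsPi m ψ ∧ φ = neg (ex ψ)

/-- `φ` is `Σ¹_m` (boldface): a closed set for `m = 0`, and `∃ y ∈ ω^ω, ψ` with `ψ` in
`Π¹_{m-1}` for `m > 0`. -/
def IsSigma : ℕ → ∀ {n : ℕ}, ProjFormula n → Prop
  | 0, _, φ => ∃ T, φ = closed T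
  | m + 1, n, φ => ∃ ψ : ProjFormula (n + 1), IsPi m ψ ∧ φ = ex ψ

variable {P : Type u} [Preorder P]

/-- The statement `φ(x)` of the forcing language, interpreted in the extension. For a tree `T` of
the ground model, `x ∈ [T]` says that for every `k < ω` there is a node `s ∈ T` of length `k`
such that `x_l(i) = s_i(l)` for all `i < k` and all `l`. -/
def forces : ∀ {n : ℕ}, ProjFormula n → (Fin n → Name P) → Stmt P
  | n, closed T, x =>
    all fun k : ℕ => Forcing.ex fun s : {s : List (Fin n → ℕ) // s ∈ T ∧ s.length = k} =>
      all fun i : Fin s.1.length => all fun l : Fin n => value (x l) i (s.1.get i l)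
  | _, neg φ, x => not (forces φ x)
  | _, ex φ, x =>
    Forcing.ex fun y : Name P => and (isReal y) (forces φ (Fin.snoc x y))

end ProjFormula

/-! ### Ultrapowers -/

section Ultrapower

variable {P K : Type u} [Preorder P]

/-- The `D`-ultrapower `P^K / D`: functions `K → P` modulo equality on a set in `D`, ordered by
`p̄ ≤ q̄` iff `p α ≤ q α` for `D`-many `α`. -/
abbrev Ultrapower (P : Type u) (D : Ultrafilter K) : Type u := (D : Filter K).Germ P

/-- The class `p̄` of `p : K → P` in the ultrapower. -/
def Ultrapower.mk (D : Ultrafilter K) (p : K → P) : Ultrapower P D := (p : (D : Filter K).Germ P)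

/-- `F` is the `P^K / D`-name `⟨f α⟩_α / D` of a real (which is determined up to forced equality):
there are, for all `α` and `n`, a maximal antichain `{a α n j : j < ω}` of `P` (enumerated possibly
with repetitions) and a function `k α n` with `a α n j ⊩ f α (n) = k α n j`, and functions `h n`
with `k α n = h n` for all `n`, for `D`-many `α`, such that the class of `⟨a α n j⟩_α` forces
`F(n) = h n j` for all `n` and `j`. -/
def IsUltrapowerName (D : Ultrafilter K) (f : K → Name P) (F : Name (Ultrapower P D)) : Prop :=
  IsRealName F ∧
  ∃ (a : K → ℕ → ℕ → P) (k : K → ℕ → ℕ → ℕ) (h : ℕ → ℕ → ℕ),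
    (∀ α n, IsMaxAntichain (Set.range (a α n))) ∧
    (∀ α n j, value (f α) n (k α n j) (a α n j)) ∧
    (∀ᶠ α in (D : Filter K), ∀ n, k α n = h n) ∧
    (∀ n j, value F n (h n j) (Ultrapower.mk D fun α => a α n j))

end Ultrapower

end Forcing

namespace Forcing

/-! ### Forced equality and membership. -/

section Basic

variable {P : Type u} [Preorder P]

/-! This is Łoś's theorem with forcing in place of truth: `IsLos` passes through the constructs from
which projective statements are built. Negation is handled by choosing conditions coordinatewise;
countable quantifiers use the countable completeness of `D`. In the atomic case, `p` forces `f(n) =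
m` iff every member of a deciding maximal antichain that is compatible with `p` carries the value
`m` (`value_iff_of_predense`). This is a countable conjunction of statements about compatibility,
which is computed coordinatewise.

The quantifier over reals requires matching names on the two sides. A sequence of names of reals
yields an ultrapower name, since each decided value is constant on a set in `D`
(`exists_isUltrapowerName`). Conversely, once the ultrapower is ccc, a name of a real is given by
countable maximal antichains, one for each `n`, whose coordinates are maximal antichains of `P` for
`D`-many `α` (`exists_isUltrapowerName_right`). The ultrapower is ccc (`CCC.ultrapower`) because `κ`
exceeds `ℵ₁`: the pairwise incompatibility of `ℵ₁` classes holds simultaneously at some coordinate.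
-/

theorem eq_mono {σ τ : Name P} {p q : P} (h : eq σ τ p) (hq : q ≤ p) : eq σ τ q := by
  obtain ⟨ι, A, c⟩ := σ
  obtain ⟨κ, B, d⟩ := τ
  rw [eq] at h ⊢
  exact ⟨fun i r hr => h.1 i r (hr.trans hq), fun j r hr => h.2 j r (hr.trans hq)⟩

theorem eq_of_dense {σ τ : Name P} {p : P} (h : ∀ q, q ≤ p → ∃ r, r ≤ q ∧ eq σ τ r) :
    eq σ τ p := by
  obtain ⟨ι, A, c⟩ := σ
  obtain ⟨κ, B, d⟩ := τ
  rw [eq]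
  constructor
  · intro i q hq hi
    obtain ⟨r, hr, e⟩ := h q hq
    rw [eq] at e
    obtain ⟨s, hs, j, hj⟩ := e.1 i r le_rfl (hr.trans hi)
    exact ⟨s, hs.trans hr, j, hj⟩
  · intro j q hq hj
    obtain ⟨r, hr, e⟩ := h q hq
    rw [eq] at e
    obtain ⟨s, hs, i, hi⟩ := e.2 j r le_rfl (hr.trans hj)
    exact ⟨s, hs.trans hr, i, hi⟩

theorem eq_refl (σ : Name P) (p : P) : eq σ σ p := by
  induction σ generalizing p with
  | mk ι A c ih =>
    rw [eq]
    exact ⟨fun i q _ hi => ⟨q, le_rfl, i, hi, ih i q⟩, fun i q _ hi => ⟨q, le_rfl, i, hi, ih i q⟩⟩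

theorem eq_symm {σ τ : Name P} {p : P} (h : eq σ τ p) : eq τ σ p := by
  induction σ generalizing τ p with
  | mk ι A c ih =>
    obtain ⟨κ, B, d⟩ := τ
    rw [eq] at h ⊢
    constructor
    · intro j q hq hj
      obtain ⟨r, hr, i, hi, e⟩ := h.2 j q hq hj
      exact ⟨r, hr, i, hi, ih i e⟩
    · intro i q hq hi
      obtain ⟨r, hr, j, hj, e⟩ := h.1 i q hq hi
      exact ⟨r, hr, j, hj, ih i e⟩

theorem eq_trans {σ τ ρ : Name P} {p : P} (h : eq σ τ p) (h' : eq τ ρ p) : eq σ ρ p := by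
  induction σ generalizing τ ρ p with
  | mk ι A c ih =>
    obtain ⟨κ, B, d⟩ := τ
    obtain ⟨μ, C, e⟩ := ρ
    rw [eq] at h h' ⊢
    constructor
    · intro i q hq hi
      obtain ⟨r, hr, j, hj, e₁⟩ := h.1 i q hq hi
      obtain ⟨s, hs, l, hl, e₂⟩ := h'.1 j r (hr.trans hq) hj
      exact ⟨s, hs.trans hr, l, hl, ih i (eq_mono e₁ hs) e₂⟩
    · intro l q hq hl
      obtain ⟨r, hr, j, hj, e₁⟩ := h'.2 l q hq hl
      obtain ⟨s, hs, i, hi, e₂⟩ := h.2 j r (hr.trans hq) hj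
      exact ⟨s, hs.trans hr, i, hi, ih i e₂ (eq_mono e₁ hs)⟩

theorem mem_mono {σ τ : Name P} {p q : P} (h : mem σ τ p) (hq : q ≤ p) : mem σ τ q := by
  obtain ⟨κ, B, d⟩ := τ
  exact fun r hr => h r (hr.trans hq)

theorem mem_of_dense {σ τ : Name P} {p : P} (h : ∀ q, q ≤ p → ∃ r, r ≤ q ∧ mem σ τ r) :
    mem σ τ p := by
  obtain ⟨κ, B, d⟩ := τ
  intro q hq
  obtain ⟨r, hr, e⟩ := h q hq
  obtain ⟨s, hs, j⟩ := e r le_rfl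
  exact ⟨s, hs.trans hr, j⟩

theorem mem_congr_left {σ σ' τ : Name P} {p : P} (h : eq σ σ' p) (hm : mem σ τ p) :
    mem σ' τ p := by
  obtain ⟨κ, B, d⟩ := τ
  intro q hq
  obtain ⟨r, hr, j, hj, e⟩ := hm q hq
  exact ⟨r, hr, j, hj, eq_trans (eq_symm (eq_mono h (hr.trans hq))) e⟩

/-! ### Check names and pairs -/

theorem eq_check_iff {x y : PSet.{u}} {p : P} :
    eq (Name.check x) (Name.check y) p ↔ PSet.Equiv x y := by
  induction x generalizing y p with
  | mk α A ih =>
    obtain ⟨β, B⟩ := y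
    rw [Name.check, Name.check, eq]
    constructor
    · intro h
      constructor
      · intro i
        -- Check names attach every condition to every member, so `p` itself can be used.
        obtain ⟨r, -, j, -, e⟩ := h.1 (i, p) p le_rfl le_rfl
        exact ⟨j.1, (ih i).1 e⟩
      · intro j
        obtain ⟨r, -, i, -, e⟩ := h.2 (j, p) p le_rfl le_rfl
        exact ⟨i.1, (ih i.1).1 e⟩
    · intro h
      constructor
      · rintro ⟨i, s⟩ q - -
        obtain ⟨j, hj⟩ := h.1 i
        exact ⟨q, le_rfl, (j, q), le_rfl, (ih i).2 hj⟩
      · rintro ⟨j, s⟩ q - -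
        obtain ⟨i, hi⟩ := h.2 j
        exact ⟨q, le_rfl, (i, q), le_rfl, (ih i).2 hi⟩

theorem ofNat_mem_ofNat {m n : ℕ} (h : m < n) : PSet.ofNat.{u} m ∈ PSet.ofNat.{u} n := by
  induction n with
  | zero => omega
  | succ n ih =>
    change _ ∈ insert (PSet.ofNat n) (PSet.ofNat n)
    rw [PSet.mem_insert_iff]
    rcases Nat.lt_succ_iff_lt_or_eq.1 h with h | rfl
    · exact Or.inr (ih h)
    · exact Or.inl (PSet.Equiv.refl _)

theorem ofNat_equiv_iff {m n : ℕ} : PSet.Equiv (PSet.ofNat.{u} m) (PSet.ofNat.{u} n) ↔ m = n := by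
  refine ⟨fun h => ?_, fun h => h ▸ PSet.Equiv.refl _⟩
  rcases lt_trichotomy m n with hl | hl | hl
  · exact absurd ((PSet.Mem.congr_left h).1 (ofNat_mem_ofNat hl)) (PSet.mem_irrefl _)
  · exact hl
  · exact absurd ((PSet.Mem.congr_left h).2 (ofNat_mem_ofNat hl)) (PSet.mem_irrefl _)

theorem eq_nat_iff {m n : ℕ} {p : P} : eq (Name.nat m) (Name.nat n) p ↔ m = n :=
  eq_check_iff.trans ofNat_equiv_iff

theorem mem_omega_iff {x : Name P} {p : P} :
    mem x Name.omega p ↔ ∀ q, q ≤ p → ∃ r, r ≤ q ∧ ∃ n, eq x (Name.nat n) r := by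
  rw [Name.omega, PSet.omega, Name.check, mem]
  refine forall₂_congr fun q _ => exists_congr fun r => and_congr_right fun _ => ?_
  constructor
  · rintro ⟨j, -, e⟩
    exact ⟨_, e⟩
  · rintro ⟨n, e⟩
    exact ⟨(⟨n⟩, r), le_rfl, e⟩

theorem mem_nat_omega (n : ℕ) (p : P) : mem (Name.nat n) Name.omega p :=
  mem_omega_iff.2 fun q _ => ⟨q, le_rfl, n, eq_refl _ _⟩

theorem upair_congr {a b c d : Name P} {p : P} (h : eq a c p) (h' : eq b d p) :
    eq (Name.upair a b) (Name.upair c d) p := by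
  rw [Name.upair, Name.upair, eq]
  constructor <;>
  · rintro ⟨⟨_ | _⟩, s⟩ q hq -
    · exact ⟨q, le_rfl, (⟨false⟩, q), le_rfl, eq_mono h' hq⟩
    · exact ⟨q, le_rfl, (⟨true⟩, q), le_rfl, eq_mono h hq⟩

theorem opair_congr {a b c d : Name P} {p : P} (h : eq a c p) (h' : eq b d p) :
    eq (Name.opair a b) (Name.opair c d) p :=
  upair_congr (upair_congr h h) (upair_congr h h')

theorem exists_eq_of_upair_eq {a b c d : Name P} {p : P}
    (h : eq (Name.upair a b) (Name.upair c d) p) :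
    ∃ q, q ≤ p ∧ ((eq a c q ∧ eq b d q) ∨ (eq a d q ∧ eq b c q)) := by
  rw [Name.upair, Name.upair, eq] at h
  have L : ∀ (i : Bool) (q : P), q ≤ p → ∃ r, r ≤ q ∧ (eq (if i then a else b) c r ∨
      eq (if i then a else b) d r) := by
    intro i q hq
    obtain ⟨r, hr, ⟨⟨_ | _⟩, s⟩, -, e⟩ := h.1 (⟨i⟩, q) q hq le_rfl
    · exact ⟨r, hr, Or.inr e⟩
    · exact ⟨r, hr, Or.inl e⟩
  have R : ∀ (j : Bool) (q : P), q ≤ p → ∃ r, r ≤ q ∧ (eq a (if j then c else d) r ∨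
      eq b (if j then c else d) r) := by
    intro i q hq
    obtain ⟨r, hr, ⟨⟨_ | _⟩, s⟩, -, e⟩ := h.2 (⟨i⟩, q) q hq le_rfl
    · exact ⟨r, hr, Or.inr e⟩
    · exact ⟨r, hr, Or.inl e⟩
  -- Four successive extensions decide a partner for `a`, `b`, `c` and `d` in turn.
  obtain ⟨q₁, h₁, e₁⟩ := L true p le_rfl
  obtain ⟨q₂, h₂, e₂⟩ := L false q₁ h₁
  obtain ⟨q₃, h₃, e₃⟩ := R true q₂ (h₂.trans h₁)
  obtain ⟨q₄, h₄, e₄⟩ := R false q₃ (h₃.trans (h₂.trans h₁))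
  refine ⟨q₄, h₄.trans (h₃.trans (h₂.trans h₁)), ?_⟩
  have h₃' := h₄.trans h₃
  have h₂' := h₃'.trans h₂
  replace e₁ := e₁.imp (eq_mono · h₂') (eq_mono · h₂')
  replace e₂ := e₂.imp (eq_mono · h₃') (eq_mono · h₃')
  replace e₃ := e₃.imp (eq_mono · h₄) (eq_mono · h₄)
  simp only [if_true, Bool.false_eq_true, if_false] at e₁ e₂ e₃ e₄
  have S : ∀ {x y}, eq x y q₄ → eq y x q₄ := eq_symm
  have T : ∀ {x y z}, eq x y q₄ → eq y z q₄ → eq x z q₄ := eq_trans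
  rcases e₁ with e₁ | e₁ <;> rcases e₂ with e₂ | e₂
  · rcases e₄ with e₄ | e₄
    · exact Or.inl ⟨e₁, T e₂ (T (S e₁) e₄)⟩
    · exact Or.inl ⟨e₁, e₄⟩
  · exact Or.inl ⟨e₁, e₂⟩
  · exact Or.inr ⟨e₁, e₂⟩
  · rcases e₃ with e₃ | e₃
    · exact Or.inl ⟨e₃, e₂⟩
    · exact Or.inr ⟨e₁, e₃⟩

/-- Deciding between alternatives costs an extension, but all of them lead to the same two
equalities, so density returns these to `p`. -/
theorem opair_inj {a b c d : Name P} {p : P} (h : eq (Name.opair a b) (Name.opair c d) p) :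
    eq a c p ∧ eq b d p := by
  have key : ∀ q, q ≤ p → ∃ r, r ≤ q ∧ eq a c r ∧ eq b d r := by
    intro q hq
    obtain ⟨r, hr, ⟨h₁, h₂⟩ | ⟨h₁, h₂⟩⟩ := exists_eq_of_upair_eq (eq_mono h hq)
    · obtain ⟨s, hs, h₃⟩ := exists_eq_of_upair_eq h₁
      obtain ⟨t, ht, h₄⟩ := exists_eq_of_upair_eq (eq_mono h₂ hs)
      have h₅ : eq a c s := by tauto
      refine ⟨t, ht.trans (hs.trans hr), eq_mono h₅ ht, ?_⟩
      rcases h₄ with h₄ | h₄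
      · exact h₄.2
      · exact eq_trans h₄.2 (eq_trans (eq_symm (eq_mono h₅ ht)) h₄.1)
    -- Crossed case: `{a} = {c, d}` and `{a, b} = {c}` make all four names equal.
    · obtain ⟨s, hs, h₃⟩ := exists_eq_of_upair_eq h₁
      obtain ⟨t, ht, h₄⟩ := exists_eq_of_upair_eq (eq_mono h₂ hs)
      have h₅ : eq a c s ∧ eq a d s := by tauto
      have h₆ : eq b c t := by tauto
      exact ⟨t, ht.trans (hs.trans hr), eq_mono h₅.1 ht,
        eq_trans h₆ (eq_trans (eq_symm (eq_mono h₅.1 ht)) (eq_mono h₅.2 ht))⟩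
  exact ⟨eq_of_dense fun q hq => (key q hq).imp fun r hr => ⟨hr.1, hr.2.1⟩,
    eq_of_dense fun q hq => (key q hq).imp fun r hr => ⟨hr.1, hr.2.2⟩⟩

/-! ### Values of names of reals -/

theorem value_mono {f : Name P} {n k : ℕ} {p q : P} (h : value f n k p) (hq : q ≤ p) :
    value f n k q := mem_mono h hq

theorem isReal.exists_value {f : Name P} {p q : P} (h : isReal f p) (hq : q ≤ p) (n : ℕ) :
    ∃ r, r ≤ q ∧ ∃ k, value f n k r := by
  obtain ⟨r, hr, y, hy, hm⟩ := (h.2 (Name.nat n) q hq (mem_nat_omega n q)).1 q le_rfl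
  obtain ⟨s, hs, k, e⟩ := mem_omega_iff.1 hy r le_rfl
  exact ⟨s, hs.trans hr, k, mem_congr_left (opair_congr (eq_refl _ _) e) (mem_mono hm hs)⟩

theorem isReal.value_unique {f : Name P} {p q : P} (h : isReal f p) (hq : q ≤ p) {n k k' : ℕ}
    (hk : value f n k q) (hk' : value f n k' q) : k = k' :=
  eq_nat_iff.1 ((h.2 (Name.nat n) q hq (mem_nat_omega n q)).2 _ _ q le_rfl hk q le_rfl hk')

/-- The name of the function consisting of the pairs `(n, k)` such that `S n k` meets the generic
filter. -/
def nameOf (S : ℕ → ℕ → Set P) : Name P :=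
  ⟨{x : ℕ × ℕ × P // x.2.2 ∈ S x.1 x.2.1}, fun x => Name.opair (Name.nat x.1.1) (Name.nat x.1.2.1),
    fun x => x.1.2.2⟩

theorem mem_nameOf_iff {S : ℕ → ℕ → Set P} {z : Name P} {p : P} :
    mem z (nameOf S) p ↔ ∀ q, q ≤ p → ∃ r, r ≤ q ∧ ∃ n k, ∃ s ∈ S n k, r ≤ s ∧
      eq z (Name.opair (Name.nat n) (Name.nat k)) r := by
  rw [nameOf, mem]
  refine forall₂_congr fun q _ => exists_congr fun r => and_congr_right fun _ => ?_
  constructor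
  · rintro ⟨⟨⟨n, k, s⟩, hs⟩, hr, e⟩
    exact ⟨n, k, s, hs, hr, e⟩
  · rintro ⟨n, k, s, hs, hr, e⟩
    exact ⟨⟨⟨n, k, s⟩, hs⟩, hr, e⟩

theorem value_nameOf_iff {S : ℕ → ℕ → Set P} {n k : ℕ} {p : P} :
    value (nameOf S) n k p ↔ ∀ q, q ≤ p → ∃ r, r ≤ q ∧ ∃ s ∈ S n k, r ≤ s := by
  rw [value, mem_nameOf_iff]
  refine forall₂_congr fun q _ => exists_congr fun r => and_congr_right fun _ => ?_
  constructor
  · rintro ⟨n', k', s, hs, hr, e⟩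
    obtain ⟨e₁, e₂⟩ := opair_inj e
    obtain rfl := eq_nat_iff.1 e₁
    obtain rfl := eq_nat_iff.1 e₂
    exact ⟨s, hs, hr⟩
  · rintro ⟨s, hs, hr⟩
    exact ⟨n, k, s, hs, hr, eq_refl _ _⟩

theorem value_nameOf {S : ℕ → ℕ → Set P} {n k : ℕ} {p : P} (h : p ∈ S n k) :
    value (nameOf S) n k p :=
  value_nameOf_iff.2 fun q hq => ⟨q, le_rfl, p, h, hq⟩

theorem isRealName_nameOf {S : ℕ → ℕ → Set P}
    (h₁ : ∀ n k k', ∀ s ∈ S n k, ∀ s' ∈ S n k', Compat s s' → k = k')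
    (h₂ : ∀ n q, ∃ k, ∃ s ∈ S n k, Compat q s) : IsRealName (nameOf S) := by
  refine fun p => ⟨fun z q _ hz r hr => ?_, fun x q _ hx => ⟨fun r hr => ?_, ?_⟩⟩
  · obtain ⟨t, ht, n, k, s, hs, hts, e⟩ := mem_nameOf_iff.1 hz r hr
    exact ⟨t, ht, Name.nat n, mem_nat_omega _ _, fun w hw =>
      ⟨w, le_rfl, Name.nat k, mem_nat_omega _ _, eq_mono e hw⟩⟩
  · obtain ⟨t, ht, n, e⟩ := mem_omega_iff.1 hx r hr
    obtain ⟨k, s, hs, w, hwt, hws⟩ := h₂ n t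
    exact ⟨w, hwt.trans ht, Name.nat k, mem_nat_omega _ _,
      mem_congr_left (opair_congr (eq_symm (eq_mono e hwt)) (eq_refl _ _))
        (mem_mono (value_nameOf hs) hws)⟩
  · intro y y' r hr hy t ht hy'
    refine eq_of_dense fun q hq => ?_
    obtain ⟨q₁, hq₁, n, k, s, hs, hts, e⟩ := mem_nameOf_iff.1 hy q (hq.trans ht)
    obtain ⟨q₂, hq₂, n', k', s', hs', hts', e'⟩ := mem_nameOf_iff.1 hy' q₁ (hq₁.trans hq)
    obtain ⟨a, b⟩ := opair_inj (eq_mono e hq₂)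
    obtain ⟨a', b'⟩ := opair_inj e'
    obtain rfl := eq_nat_iff.1 (eq_trans (eq_symm a) a')
    obtain rfl := h₁ n k k' s hs s' hs' ⟨q₂, hq₂.trans hts, hts'⟩
    exact ⟨q₂, hq₂.trans hq₁, eq_trans b (eq_symm b')⟩

/-- A name that is forced by `r` to be a real agrees below `r` with a name of a real. -/
theorem exists_isRealName_of_isReal {y : Name P} {r : P} (h : isReal y r) :
    ∃ y', IsRealName y' ∧ ∀ q, q ≤ r → ∀ n k, value y' n k q ↔ value y n k q := by
  -- Below `r` the name copies `y`; conditions incompatible with `r` receive the default value `0`,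
  -- which makes it total.
  refine ⟨nameOf fun n k => {s | (s ≤ r ∧ value y n k s) ∨ (¬ Compat s r ∧ k = 0)},
    isRealName_nameOf ?_ ?_, fun q hq n k => ⟨fun hv => ?_, fun hv => ?_⟩⟩
  · rintro n k k' s (⟨hs, hv⟩ | ⟨hs, rfl⟩) s' (⟨hs', hv'⟩ | ⟨hs', rfl⟩) ⟨t, ht, ht'⟩
    · exact h.value_unique (ht.trans hs) (value_mono hv ht) (value_mono hv' ht')
    · exact absurd ⟨t, ht', ht.trans hs⟩ hs'
    · exact absurd ⟨t, ht, ht'.trans hs'⟩ hs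
    · rfl
  · intro n q
    by_cases hq : Compat q r
    · obtain ⟨t, htq, htr⟩ := hq
      obtain ⟨s, hs, k, hv⟩ := h.exists_value htr n
      exact ⟨k, s, Or.inl ⟨hs.trans htr, hv⟩, s, hs.trans htq, le_rfl⟩
    · exact ⟨0, q, Or.inr ⟨hq, rfl⟩, q, le_rfl, le_rfl⟩
  · refine mem_of_dense fun t ht => ?_
    obtain ⟨w, hw, s, ⟨-, hv⟩ | ⟨hs, -⟩, hws⟩ := value_nameOf_iff.1 hv t ht
    · exact ⟨w, hw, mem_mono hv hws⟩
    · exact absurd ⟨w, hws, hw.trans (ht.trans hq)⟩ hs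
  · exact value_nameOf (Or.inl ⟨hq, hv⟩)

/-- Formulas see their arguments only through `value`, so a name may be replaced by one with the
same values. -/
theorem ProjFormula.forces_congr {n : ℕ} (φ : ProjFormula n) {x x' : Fin n → Name P} {p : P}
    (h : ∀ q, q ≤ p → ∀ l i k, value (x l) i k q ↔ value (x' l) i k q) :
    φ.forces x p ↔ φ.forces x' p := by
  induction φ generalizing p with
  | closed T =>
    refine forall_congr' fun k => forall₂_congr fun q hq => exists_congr fun r =>
      and_congr_right fun hr => exists_congr fun s => forall₂_congr fun i l =>
        h r (hr.trans hq) l _ _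
  | neg φ ih =>
    exact forall₂_congr fun q hq => not_congr (ih fun r hr => h r (hr.trans hq))
  | ex φ ih =>
    refine forall₂_congr fun q hq => exists_congr fun r => and_congr_right fun hr =>
      exists_congr fun y => and_congr_right fun _ => ih fun s hs l i k => ?_
    refine Fin.lastCases ?_ (fun l => ?_) l
    · simp
    · simpa using h s (hs.trans (hr.trans hq)) l i k

/-! ### Antichains that decide values -/

theorem IsMaxAntichain.eq_of_compat {A : Set P} (hA : IsMaxAntichain A) {a b : P} (ha : a ∈ A)
    (hb : b ∈ A) (h : Compat a b) : a = b := by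
  by_contra hne
  exact hA.1 ha hb hne h

/-- An antichain maximal within the dense set `S` is maximal outright: a condition incompatible with
all of it would have an extension in `S` that could be added. -/
theorem exists_maxAntichain_subset {S : Set P} (hS : ∀ q, ∃ r ∈ S, r ≤ q) :
    ∃ A ⊆ S, IsMaxAntichain A := by
  obtain ⟨A, hA⟩ := zorn_subset {A : Set P | A ⊆ S ∧ IsIncompatFamily A} (by
    intro c hc hchain
    refine ⟨⋃₀ c, ⟨Set.sUnion_subset fun A hA => (hc hA).1, ?_⟩, fun A => Set.subset_sUnion_of_mem⟩
    exact (Set.pairwise_sUnion hchain.directedOn).2 fun A hA => (hc hA).2)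
  refine ⟨A, hA.prop.1, hA.prop.2, fun q => ?_⟩
  by_contra! hq
  obtain ⟨r, hr, hrq⟩ := hS q
  have hrA : ∀ a ∈ A, ¬ Compat r a := fun a ha ⟨t, ht, ht'⟩ => hq a ha ⟨t, ht.trans hrq, ht'⟩
  have : r ∈ A := hA.le_of_ge (y := insert r A)
    ⟨Set.insert_subset hr hA.prop.1, hA.prop.2.insert fun a ha _ =>
      ⟨hrA a ha, fun ⟨t, ht, ht'⟩ => hrA a ha ⟨t, ht', ht⟩⟩⟩ (Set.subset_insert r A)
    (Set.mem_insert r A)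
  exact hrA r this ⟨r, le_rfl, le_rfl⟩

theorem CCC.exists_maxAntichain_value [Nonempty P] (hP : CCC P) {f : Name P} (hf : IsRealName f)
    (n : ℕ) : ∃ (a : ℕ → P) (k : ℕ → ℕ), IsMaxAntichain (Set.range a) ∧
      ∀ j, value f n (k j) (a j) := by
  obtain ⟨A, hAS, hA⟩ := exists_maxAntichain_subset (S := {p : P | ∃ k, value f n k p}) fun q => by
    obtain ⟨r, hr, hk⟩ := (hf q).exists_value le_rfl n
    exact ⟨r, hk, hr⟩
  obtain ⟨a, ha, -⟩ := hA.2 (Classical.arbitrary P)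
  obtain ⟨a, rfl⟩ := (hP A hA.1).exists_eq_range ⟨a, ha⟩
  choose k hk using fun j => hAS (Set.mem_range_self j)
  exact ⟨a, k, hA, hk⟩

theorem value_iff_of_predense {f : Name P} (hf : IsRealName f) {n : ℕ} {a : ℕ → P} {k : ℕ → ℕ}
    (ha : ∀ q, ∃ j, Compat q (a j)) (hk : ∀ j, value f n (k j) (a j)) {m : ℕ} {p : P} :
    value f n m p ↔ ∀ j, Compat p (a j) → k j = m := by
  constructor
  · rintro h j ⟨r, hr, hr'⟩
    exact (hf r).value_unique le_rfl (value_mono (hk j) hr') (value_mono h hr)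
  · intro h
    refine mem_of_dense fun q hq => ?_
    obtain ⟨j, r, hr, hr'⟩ := ha q
    rw [← h j ⟨r, hr.trans hq, hr'⟩]
    exact ⟨r, hr, value_mono (hk j) hr'⟩

theorem IsMaxAntichain.exists_compat {a : ℕ → P} (h : IsMaxAntichain (Set.range a)) (q : P) :
    ∃ j, Compat q (a j) := by
  obtain ⟨_, ⟨j, rfl⟩, hj⟩ := h.2 q
  exact ⟨j, hj⟩

theorem exists_isRealName_value {a : ℕ → ℕ → P} {k : ℕ → ℕ → ℕ}
    (ha : ∀ n q, ∃ j, Compat q (a n j)) (hk : ∀ n i j, Compat (a n i) (a n j) → k n i = k n j) :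
    ∃ f, IsRealName f ∧ ∀ n j, value f n (k n j) (a n j) := by
  refine ⟨nameOf fun n m => {s | ∃ j, a n j = s ∧ k n j = m}, isRealName_nameOf ?_ ?_,
    fun n j => value_nameOf ⟨j, rfl, rfl⟩⟩
  · rintro n _ _ _ ⟨i, rfl, rfl⟩ _ ⟨j, rfl, rfl⟩ h
    exact hk n i j h
  · intro n q
    obtain ⟨j, hj⟩ := ha n q
    exact ⟨k n j, a n j, ⟨j, rfl, rfl⟩, hj⟩

end Basic

/-! ### Łoś's theorem for the forcing relation -/

section Los

open Filter

variable {P K : Type u} {D : Ultrafilter K}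

theorem Ultrapower.exists_mk (p : Ultrapower P D) : ∃ q : K → P, Ultrapower.mk D q = p :=
  Quotient.exists_rep p

theorem Ultrapower.mk_eq_mk {p q : K → P} :
    Ultrapower.mk D p = Ultrapower.mk D q ↔ ∀ᶠ α in (D : Filter K), p α = q α :=
  Germ.coe_eq

/-- Pigeonhole for a countably complete ultrafilter: otherwise countably many complements would meet
in a set of `D` without witnesses. -/
theorem exists_eventually_of_eventually_exists [CountableInterFilter (D : Filter K)] {X : Type*}
    [Countable X] {R : K → X → Prop} (h : ∀ᶠ α in (D : Filter K), ∃ x, R α x) :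
    ∃ x, ∀ᶠ α in (D : Filter K), R α x := by
  by_contra hx
  have hn : ∀ x, ∀ᶠ α in (D : Filter K), ¬ R α x := fun x =>
    Ultrafilter.eventually_not.2 fun hR => hx ⟨x, hR⟩
  obtain ⟨α, ⟨x, h⟩, h'⟩ := (h.and (eventually_countable_forall.2 hn)).exists
  exact h' x h

/-- The statement `Φ` about the ultrapower is forced exactly by the classes of those `p` such that
`p α` forces `φ α` for `D`-many `α`. -/
def IsLos (D : Ultrafilter K) (Φ : Stmt (Ultrapower P D)) (φ : K → Stmt P) : Prop :=
  ∀ p : K → P, Φ (Ultrapower.mk D p) ↔ ∀ᶠ α in (D : Filter K), φ α (p α)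

theorem IsLos.all [CountableInterFilter (D : Filter K)] {X : Type*} [Countable X]
    {Φ : X → Stmt (Ultrapower P D)} {φ : K → X → Stmt P} (h : ∀ x, IsLos D (Φ x) fun α => φ α x) :
    IsLos D (all Φ) fun α => Forcing.all (φ α) := fun p =>
  (forall_congr' fun x => h x p).trans eventually_countable_forall.symm

variable [Preorder P]

theorem Ultrapower.mk_le_mk {p q : K → P} :
    Ultrapower.mk D p ≤ Ultrapower.mk D q ↔ ∀ᶠ α in (D : Filter K), p α ≤ q α :=
  Germ.coe_le

theorem Ultrapower.compat_mk {p q : K → P} :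
    Compat (Ultrapower.mk D p) (Ultrapower.mk D q) ↔
      ∀ᶠ α in (D : Filter K), Compat (p α) (q α) := by
  constructor
  · rintro ⟨r, h, h'⟩
    obtain ⟨r, rfl⟩ := Ultrapower.exists_mk r
    filter_upwards [Ultrapower.mk_le_mk.1 h, Ultrapower.mk_le_mk.1 h'] with α h h'
    exact ⟨r α, h, h'⟩
  · intro h
    obtain ⟨r, hr⟩ := h.choice
    exact ⟨Ultrapower.mk D r, Ultrapower.mk_le_mk.2 (hr.mono fun _ => And.left),
      Ultrapower.mk_le_mk.2 (hr.mono fun _ => And.right)⟩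

theorem IsLos.not {Φ : Stmt (Ultrapower P D)} {φ : K → Stmt P} (h : IsLos D Φ φ) :
    IsLos D (not Φ) fun α => Forcing.not (φ α) := by
  intro p
  constructor
  · intro hp
    by_contra hn
    have : ∀ᶠ α in (D : Filter K), ∃ q, q ≤ p α ∧ φ α q := by
      filter_upwards [Ultrafilter.eventually_not.2 hn] with α hα
      simpa [Forcing.not] using hα
    obtain ⟨q, hq⟩ := this.choice
    exact hp _ (Ultrapower.mk_le_mk.2 (hq.mono fun _ => And.left))
      ((h q).2 (hq.mono fun _ => And.right))
  · intro hp q hq hΦ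
    obtain ⟨q, rfl⟩ := Ultrapower.exists_mk q
    obtain ⟨α, h₁, h₂, h₃⟩ := (hp.and ((Ultrapower.mk_le_mk.1 hq).and ((h q).1 hΦ))).exists
    exact h₁ _ h₂ h₃

/-- Łoś's theorem for a quantifier whose witnesses on the two sides are matched with each other. -/
theorem IsLos.ex_of_forall {X Y : Type*} {Φ : X → Stmt (Ultrapower P D)} {φ : Y → K → Stmt P}
    (h₁ : ∀ x (r : K → P), Φ x (Ultrapower.mk D r) →
      ∀ᶠ α in (D : Filter K), ∃ y, φ y α (r α))
    (h₂ : ∀ r : K → P, (∀ᶠ α in (D : Filter K), ∃ y, φ y α (r α)) →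
      ∃ x, Φ x (Ultrapower.mk D r)) :
    IsLos D (ex Φ) fun α => Forcing.ex fun y => φ y α := by
  intro p
  constructor
  · intro hp
    by_contra hn
    -- Conditions `q α` with no witness below them form a class with no witness below it.
    have : ∀ᶠ α in (D : Filter K), ∃ q, q ≤ p α ∧ ∀ r, r ≤ q → ∀ y, ¬ φ y α r := by
      filter_upwards [Ultrafilter.eventually_not.2 hn] with α hα
      simpa [Forcing.ex] using hα
    obtain ⟨q, hq⟩ := this.choice
    obtain ⟨r, hr, x, hx⟩ := hp _ (Ultrapower.mk_le_mk.2 (hq.mono fun _ => And.left))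
    obtain ⟨r, rfl⟩ := Ultrapower.exists_mk r
    obtain ⟨α, ⟨-, e₁⟩, e₂, y, e₃⟩ := (hq.and ((Ultrapower.mk_le_mk.1 hr).and (h₁ x r hx))).exists
    exact e₁ _ e₂ y e₃
  · intro hp q hq
    obtain ⟨q, rfl⟩ := Ultrapower.exists_mk q
    have : ∀ᶠ α in (D : Filter K), ∃ r, r ≤ q α ∧ ∃ y, φ y α r := by
      filter_upwards [hp, Ultrapower.mk_le_mk.1 hq] with α e₁ e₂
      exact e₁ _ e₂
    obtain ⟨r, hr⟩ := this.choice
    exact ⟨Ultrapower.mk D r, Ultrapower.mk_le_mk.2 (hr.mono fun _ => And.left),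
      h₂ r (hr.mono fun _ => And.right)⟩

theorem IsLos.ex [CountableInterFilter (D : Filter K)] {X : Type*} [Countable X]
    {Φ : X → Stmt (Ultrapower P D)} {φ : X → K → Stmt P} (h : ∀ x, IsLos D (Φ x) (φ x)) :
    IsLos D (ex Φ) fun α => Forcing.ex fun x => φ x α :=
  IsLos.ex_of_forall (fun x r hx => ((h x r).1 hx).mono fun _ hα => ⟨x, hα⟩) fun r hr =>
    (exists_eventually_of_eventually_exists hr).imp fun x => (h x r).2

/-! ### Atomic statements and ultrapower names of sequences. -/

theorem Ultrapower.exists_compat [CountableInterFilter (D : Filter K)] {a : K → ℕ → P}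
    (ha : ∀ α, IsMaxAntichain (Set.range (a α))) (q : Ultrapower P D) :
    ∃ j, Compat q (Ultrapower.mk D fun α => a α j) := by
  obtain ⟨q, rfl⟩ := Ultrapower.exists_mk q
  obtain ⟨j, hj⟩ := exists_eventually_of_eventually_exists
    (Eventually.of_forall (f := (D : Filter K)) fun α => (ha α).exists_compat (q α))
  exact ⟨j, Ultrapower.compat_mk.2 hj⟩

theorem IsUltrapowerName.isLos_value [CountableInterFilter (D : Filter K)] {f : K → Name P}
    {F : Name (Ultrapower P D)} (h : IsUltrapowerName D f F) (hf : ∀ α, IsRealName (f α))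
    (n m : ℕ) : IsLos D (value F n m) fun α => value (f α) n m := by
  obtain ⟨hF, a, k, b, ha, hk, hkb, hb⟩ := h
  intro p
  have h₁ : ∀ α q, value (f α) n m q ↔ ∀ j, Compat q (a α n j) → k α n j = m := fun α q =>
    value_iff_of_predense (hf α) (ha α n).exists_compat (hk α n)
  rw [value_iff_of_predense hF (Ultrapower.exists_compat fun α => ha α n) (hb n)]
  simp only [h₁, Ultrapower.compat_mk]
  rw [eventually_countable_forall]
  refine forall_congr' fun j => ?_
  rw [Ultrafilter.eventually_imp]
  refine imp_congr_right fun _ => ?_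
  constructor
  · intro e
    filter_upwards [hkb] with α hα
    rw [hα, e]
  · intro e
    obtain ⟨α, e₁, e₂⟩ := (e.and hkb).exists
    rw [← e₁, e₂]

theorem exists_isUltrapowerName [Nonempty P] [CountableInterFilter (D : Filter K)] (hP : CCC P)
    {f : K → Name P} (hf : ∀ α, IsRealName (f α)) :
    ∃ F : Name (Ultrapower P D), IsUltrapowerName D f F := by
  choose a k ha hk using fun α n => hP.exists_maxAntichain_value (hf α) n
  have : ∀ n j, ∃ m, ∀ᶠ α in (D : Filter K), k α n j = m := fun n j =>
    exists_eventually_of_eventually_exists (Eventually.of_forall fun α => ⟨_, rfl⟩)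
  choose b hb using this
  obtain ⟨F, hF, hv⟩ := exists_isRealName_value
    (a := fun n j => Ultrapower.mk D fun α => a α n j) (k := b)
    (fun n => Ultrapower.exists_compat fun α => ha α n) (by
      intro n i j hij
      -- At such a coordinate, compatible members of the antichain coincide and hence decide the
      -- same value.
      obtain ⟨α, e, ei, ej⟩ := ((Ultrapower.compat_mk.1 hij).and ((hb n i).and (hb n j))).exists
      rw [← ei, ← ej]
      have := (ha α n).eq_of_compat (Set.mem_range_self i) (Set.mem_range_self j) e
      exact (hf α (a α n i)).value_unique le_rfl (hk α n i) (this ▸ hk α n j))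
  refine ⟨F, hF, a, k, b, ha, hk, ?_, hv⟩
  filter_upwards [eventually_countable_forall.2 fun n => eventually_countable_forall.2 (hb n)]
    with α hα n
  exact funext (hα n)

/-! ### The chain condition in the ultrapower. -/

/-- If `K` embedded in `2^ω`, countable completeness would fix all binary digits at once on a set in
`D`, making `D` principal. -/
theorem aleph_one_lt_of_nonprincipal [CountableInterFilter (D : Filter K)]
    (hD : ∀ α : K, D ≠ pure α) : Cardinal.aleph 1 < Cardinal.mk K := by
  refine lt_of_le_of_lt (b := Cardinal.continuum) Cardinal.aleph_one_le_continuum ?_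
  by_contra! hle
  have : Cardinal.lift.{0} (Cardinal.mk K) ≤ Cardinal.lift.{u} (Cardinal.mk (ℕ → Bool)) := by
    simpa using hle
  obtain ⟨e⟩ := Cardinal.lift_mk_le'.1 this
  have : ∀ n, ∃ b, ∀ᶠ α in (D : Filter K), e α n = b := fun n =>
    exists_eventually_of_eventually_exists (Eventually.of_forall fun α => ⟨_, rfl⟩)
  choose b hb using this
  replace hb := eventually_countable_forall.2 hb
  obtain ⟨α, hα⟩ := hb.exists
  refine hD α (Ultrafilter.eq_of_le (le_pure_iff.2 ?_))
  filter_upwards [hb] with β hβ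
  exact e.injective (funext fun n => (hβ n).trans (hα n).symm)

theorem CCC.ultrapower (hP : CCC P) {κ : Cardinal.{u}} [CardinalInterFilter (D : Filter K) κ]
    (hκ : Cardinal.aleph 1 < κ) : CCC (Ultrapower P D) := by
  intro A hA
  by_contra hA'
  have : Cardinal.aleph 1 ≤ Cardinal.mk A := by
    rw [← Cardinal.succ_aleph0, Order.succ_le_iff]
    exact not_le.1 fun h => hA' (Cardinal.le_aleph0_iff_set_countable.1 h)
  -- Cutting down to `ℵ₁` members leaves fewer than `κ` pairs, so `κ`-completeness applies.
  obtain ⟨B, hBA, hB⟩ := Cardinal.le_mk_iff_exists_subset.1 this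
  choose p hp using fun b : B => Ultrapower.exists_mk b.1
  have key : ∀ᶠ α in (D : Filter K), ∀ x : {x : B × B // x.1 ≠ x.2},
      ¬ Compat (p x.1.1 α) (p x.1.2 α) := by
    refine (eventually_cardinal_forall (c := κ) ?_).2 fun ⟨⟨b, c⟩, hbc⟩ => ?_
    · refine (Cardinal.mk_subtype_le _).trans_lt ?_
      rwa [← Cardinal.mul_def, hB, Cardinal.mul_eq_self (Cardinal.aleph0_le_aleph 1)]
    · rw [Ultrafilter.eventually_not, ← Ultrapower.compat_mk, hp, hp]
      exact hA (hBA b.2) (hBA c.2) fun h => hbc (Subtype.ext h)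
  obtain ⟨α, hα⟩ := key.exists
  have hinj : Function.Injective fun b => p b α := by
    intro b c hbc
    by_contra hne
    exact hα ⟨(b, c), hne⟩ ⟨p b α, le_rfl, le_of_eq hbc⟩
  have hc : (Set.range fun b => p b α).Countable := by
    refine hP _ ?_
    rintro _ ⟨b, rfl⟩ _ ⟨c, rfl⟩ hne
    exact hα ⟨(b, c), fun h => hne (by simp only at h; rw [h])⟩
  rw [← Cardinal.le_aleph0_iff_set_countable, Cardinal.mk_range_eq _ hinj, hB] at hc
  exact absurd hc (not_le.2 Cardinal.aleph0_lt_aleph_one)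

/-! ### Decomposing names of reals for the ultrapower. -/

theorem Ultrapower.eventually_isMaxAntichain [CountableInterFilter (D : Filter K)]
    {a : ℕ → K → P} (ha : IsMaxAntichain (Set.range fun j => Ultrapower.mk D (a j))) :
    ∀ᶠ α in (D : Filter K), IsMaxAntichain (Set.range fun j => a j α) := by
  have h₁ : ∀ᶠ α in (D : Filter K), ∀ i j, Compat (a i α) (a j α) → a i α = a j α := by
    refine eventually_countable_forall.2 fun i => eventually_countable_forall.2 fun j => ?_
    rw [Ultrafilter.eventually_imp, ← Ultrapower.compat_mk, ← Ultrapower.mk_eq_mk]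
    exact ha.eq_of_compat (Set.mem_range_self i) (Set.mem_range_self j)
  have h₂ : ∀ᶠ α in (D : Filter K), ∀ q, ∃ j, Compat q (a j α) := by
    by_contra hn
    have : ∀ᶠ α in (D : Filter K), ∃ q, ∀ j, ¬ Compat q (a j α) := by
      filter_upwards [Ultrafilter.eventually_not.2 hn] with α hα
      simpa using hα
    -- Coordinatewise counterexamples to maximality form a class incompatible with every member.
    obtain ⟨q, hq⟩ := this.choice
    obtain ⟨j, hj⟩ := ha.exists_compat (Ultrapower.mk D q)
    obtain ⟨α, e₁, e₂⟩ := (hq.and (Ultrapower.compat_mk.1 hj)).exists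
    exact e₁ j e₂
  filter_upwards [h₁, h₂] with α e₁ e₂
  refine ⟨?_, fun q => ?_⟩
  · rintro _ ⟨i, rfl⟩ _ ⟨j, rfl⟩ hne h
    exact hne (e₁ i j h)
  · obtain ⟨j, hj⟩ := e₂ q
    exact ⟨_, Set.mem_range_self j, hj⟩

theorem exists_isRealName : ∃ f : Name P, IsRealName f :=
  ⟨nameOf fun _ k => {_s | k = 0}, isRealName_nameOf
    (fun _ _ _ _ hs _ hs' _ => Eq.trans hs (Eq.symm hs'))
    fun _ q => ⟨0, q, rfl, q, le_rfl, le_rfl⟩⟩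

/-- Every name of a real for the ultrapower is represented by a sequence of names of reals. -/
theorem exists_isUltrapowerName_right [Nonempty P] [CountableInterFilter (D : Filter K)]
    (hP : CCC P) (hU : CCC (Ultrapower P D)) {F : Name (Ultrapower P D)} (hF : IsRealName F) :
    ∃ f : K → Name P, (∀ α, IsRealName (f α)) ∧ IsUltrapowerName D f F := by
  have : Nonempty (Ultrapower P D) := ⟨Ultrapower.mk D fun _ => Classical.arbitrary P⟩
  choose A b hA hb using fun n => hU.exists_maxAntichain_value hF n
  choose a ha using fun n j => Ultrapower.exists_mk (A n j)
  obtain rfl : (fun n j => Ultrapower.mk D (a n j)) = A := funext₂ ha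
  have hmax := eventually_countable_forall.2 fun n => Ultrapower.eventually_isMaxAntichain (hA n)
  have hcons : ∀ᶠ α in (D : Filter K), ∀ n i j, Compat (a n i α) (a n j α) → b n i = b n j := by
    refine eventually_countable_forall.2 fun n => eventually_countable_forall.2 fun i =>
      eventually_countable_forall.2 fun j => ?_
    rw [Ultrafilter.eventually_imp, ← Ultrapower.compat_mk]
    rintro ⟨r, hi, hj⟩
    exact Eventually.of_forall fun _ =>
      (hF r).value_unique le_rfl (value_mono (hb n i) hi) (value_mono (hb n j) hj)
  -- The data are required at every `α`, so bad coordinates get an arbitrary name of a real with its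
  -- own deciding antichains.
  have key : ∀ α, ∃ (y : Name P) (a' : ℕ → ℕ → P) (k : ℕ → ℕ → ℕ), IsRealName y ∧
      (∀ n, IsMaxAntichain (Set.range (a' n))) ∧ (∀ n j, value y n (k n j) (a' n j)) ∧
      ((∀ n, IsMaxAntichain (Set.range fun j => a n j α)) →
        (∀ n i j, Compat (a n i α) (a n j α) → b n i = b n j) →
        (∀ n, k n = b n) ∧ ∀ n j, a' n j = a n j α) := by
    intro α
    by_cases h : (∀ n, IsMaxAntichain (Set.range fun j => a n j α)) ∧
        ∀ n i j, Compat (a n i α) (a n j α) → b n i = b n j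
    · obtain ⟨y, hy, hv⟩ := exists_isRealName_value (fun n => (h.1 n).exists_compat) h.2
      exact ⟨y, _, b, hy, h.1, hv, fun _ _ => ⟨fun _ => rfl, fun _ _ => rfl⟩⟩
    · obtain ⟨y, hy⟩ := exists_isRealName (P := P)
      choose a' k ha' hk using fun n => hP.exists_maxAntichain_value hy n
      exact ⟨y, a', k, hy, ha', hk, fun h₁ h₂ => absurd ⟨h₁, h₂⟩ h⟩
  choose y a' k hy ha' hk hab using key
  refine ⟨y, hy, hF, a', k, b, ha', hk, ?_, fun n j => ?_⟩
  · filter_upwards [hmax, hcons] with α h₁ h₂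
    exact (hab α h₁ h₂).1
  · have : Ultrapower.mk D (fun α => a' α n j) = Ultrapower.mk D (a n j) := by
      rw [Ultrapower.mk_eq_mk]
      filter_upwards [hmax, hcons] with α h₁ h₂
      exact (hab α h₁ h₂).2 n j
    rw [this]
    exact hb n j

/-! ### Induction on projective formulas. -/

theorem ProjFormula.isLos_forces [Nonempty P] [CountableInterFilter (D : Filter K)]
    (hP : CCC P) (hU : CCC (Ultrapower P D)) {n : ℕ} (φ : ProjFormula n)
    {f : Fin n → K → Name P} (hf : ∀ l α, IsRealName (f l α))
    {F : Fin n → Name (Ultrapower P D)} (hF : ∀ l, IsUltrapowerName D (f l) (F l)) :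
    IsLos D (φ.forces F) fun α => φ.forces fun l => f l α := by
  induction φ with
  | closed T =>
    exact IsLos.all fun k => IsLos.ex fun s => IsLos.all fun i => IsLos.all fun l =>
      (hF l).isLos_value (hf l) _ _
  | neg φ ih => exact (ih hf hF).not
  | @ex n φ ih =>
    have snoc : ∀ (y : K → Name P) (Y : Name (Ultrapower P D)), (∀ α, IsRealName (y α)) →
        IsUltrapowerName D y Y →
        IsLos D (φ.forces (Fin.snoc F Y)) fun α => φ.forces (Fin.snoc (fun l => f l α) (y α)) := by
      intro y Y hy hY
      have := ih (f := Fin.snoc (α := fun _ => K → Name P) f y) (F := Fin.snoc F Y)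
        (fun l => Fin.lastCases (by simpa using hy) (fun l => by simpa using hf l) l)
        (fun l => Fin.lastCases (by simpa using hY) (fun l => by simpa using hF l) l)
      convert this using 3 with α
      refine funext fun l => Fin.lastCases ?_ (fun l => ?_) l <;> simp
    -- Used both for `P` and for its ultrapower, hence the general `Q`.
    have replace_last : ∀ {Q : Type u} [Preorder Q] (x : Fin n → Name Q) (y y' : Name Q) (r : Q),
        (∀ q, q ≤ r → ∀ n k, value y' n k q ↔ value y n k q) →
        φ.forces (Fin.snoc x y) r → φ.forces (Fin.snoc x y') r := by
      intro Q _ x y y' r h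
      refine (φ.forces_congr fun q hq l i k => ?_).1
      refine Fin.lastCases ?_ (fun l => ?_) l
      · simpa using (h q hq i k).symm
      · simp
    refine IsLos.ex_of_forall (Φ := fun Y => Forcing.and (isReal Y) (φ.forces (Fin.snoc F Y)))
      (φ := fun y α => Forcing.and (isReal y) (φ.forces (Fin.snoc (fun l => f l α) y))) ?_ ?_
    · rintro Y r ⟨hY, hφ⟩
      -- The witness is only forced by the class of `r` to be a real; it must become a name of a
      -- real everywhere before it can be decomposed.
      obtain ⟨Y', hY', hv⟩ := exists_isRealName_of_isReal hY
      obtain ⟨y, hy, hyY⟩ := exists_isUltrapowerName_right hP hU hY'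
      filter_upwards [(snoc y Y' hy hyY r).1 (replace_last F Y Y' _ hv hφ)] with α hα
      exact ⟨y α, hy α _, hα⟩
    · intro r hr
      -- Coordinates without a witness get a filler, so that the whole sequence consists of names of
      -- reals.
      have : ∀ α, ∃ y : Name P, IsRealName y ∧
          ((∃ y, Forcing.and (isReal y) (φ.forces (Fin.snoc (fun l => f l α) y)) (r α)) →
            φ.forces (Fin.snoc (fun l => f l α) y) (r α)) := by
        intro α
        by_cases h : ∃ y, Forcing.and (isReal y) (φ.forces (Fin.snoc (fun l => f l α) y)) (r α)
        · obtain ⟨y, hy, hφ⟩ := h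
          obtain ⟨y', hy', hv⟩ := exists_isRealName_of_isReal hy
          exact ⟨y', hy', fun _ => replace_last _ y y' _ hv hφ⟩
        · exact exists_isRealName.imp fun y hy => ⟨hy, fun h' => absurd h' h⟩
      choose y hy hφ using this
      obtain ⟨Y, hY⟩ := exists_isUltrapowerName (D := D) hP hy
      exact ⟨Y, hY.1 _, (snoc y Y hy hY r).2 (hr.mono fun α hα => hφ α hα)⟩

end Los

end Forcing

theorem theorem4p3
    {P : Type u} [Preorder P] [Nonempty P] (hP : Forcing.CCC P)
    {K : Type u} (κ : Cardinal.{u}) (hK : Cardinal.mk K = κ) (hκ : Cardinal.aleph0 < κ)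
    (D : Ultrafilter K) (hD : CardinalInterFilter (D : Filter K) κ)
    (hD' : ∀ α : K, D ≠ pure α)
    (f : K → Forcing.Name P) (hf : ∀ α, Forcing.IsRealName (f α)) :
    (∃ F : Forcing.Name (Forcing.Ultrapower P D), Forcing.IsUltrapowerName D f F) ∧
    ∀ F : Forcing.Name (Forcing.Ultrapower P D), Forcing.IsUltrapowerName D f F →
      ∀ (m : ℕ) (φ : Forcing.ProjFormula 1), φ.IsSigma m →
        ∀ p : K → P,
          φ.forces (fun _ => F) (Forcing.Ultrapower.mk D p) ↔
            ∀ᶠ α in (D : Filter K), φ.forces (fun _ => f α) (p α) := by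
  have : CountableInterFilter (D : Filter K) :=
    CardinalInterFilter.toCountableInterFilter (D : Filter K) hκ
  have hU : Forcing.CCC (Forcing.Ultrapower P D) :=
    hP.ultrapower (κ := κ) (hK ▸ Forcing.aleph_one_lt_of_nonprincipal hD')
  exact ⟨Forcing.exists_isUltrapowerName hP hf, fun F hF _ φ _ =>
    φ.isLos_forces hP hU (f := fun _ => f) (fun _ => hf) (fun _ => hF)⟩
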